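/- **Theorem 2.8.** For $a \ge 3$ let $C_a$ denote the cycle with $a$ vertices. For a graph $H$ and a set $\mathcal F$ of graphs, let $ex(n,H,\mathcal F)$ denote the maximum number of copies of $H$ (that is, of subgraphs isomorphic to $H$, not necessarily induced) in a simple graph on $n$ vertices that contains no member of $\mathcal F$ as a (not necessarily induced) subgraph. Let $k > l \ge 2$ be fixed integers. Then, as $n \to \infty$, $$ex\big(n,\,C_{2l+1},\,\{C_3,C_4,\dots,C_{2l}\}\cup\{C_{2k+1}\}\big)=\Omega\big(n^{1+\frac{1}{2k+2}}\big)$$ and $$ex\big(n,\,C_{2l+1},\,\{C_3,C_4,\dots,C_{2l}\}\cup\{C_{2k+1}\}\big)=O(n^{2}),$$ where the implied constants may depend on $k$ and $l$. -/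

import Mathlib

open Filter Asymptotics

/-- A graph `G` is `F`-free, for a set `F` of finite graphs, if it contains no member of `F` as a
(not necessarily induced) subgraph. -/
def FamilyFree {V : Type*} (F : Set (Σ m : ℕ, SimpleGraph (Fin m))) (G : SimpleGraph V) : Prop :=
  ∀ A ∈ F, A.2.Free G

open scoped Classical in
/-- The generalized Turán number `ex(n, H, F)`: the maximum number of (unlabelled, not necessarily
induced) copies of `H` in an `F`-free graph on `n` vertices. -/
noncomputable def generalizedTuran (n : ℕ) {W : Type*} (H : SimpleGraph W)
    (F : Set (Σ m : ℕ, SimpleGraph (Fin m))) : ℕ :=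
  ({G : SimpleGraph (Fin n) | FamilyFree F G} : Finset (SimpleGraph (Fin n))).sup
    (fun G => G.copyCount H)

/-- The cycle `C_a` as a member of a family of finite graphs. -/
def cycleMember (a : ℕ) : Σ m : ℕ, SimpleGraph (Fin m) := ⟨a, SimpleGraph.cycleGraph a⟩

/-- The family `{C_3, C_4, …, C_j}` of all cycles of length at most `j`. -/
def cyclesUpTo (j : ℕ) : Set (Σ m : ℕ, SimpleGraph (Fin m)) :=
  cycleMember '' Set.Icc 3 j

/-! Upper bound. With no cycle of length at most 2l, a path of length l is determined by its ends.
So a (2l+1)-cycle with a marked vertex x is determined by its opposite edge, which lies in the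
sphere of radius l around x. By `card_adj_pathSphere_le` that sphere spans O(n) edges: otherwise it
contains a path of length 2(k-l)+1 whose ends lie in different branches at x, and two radii close it
to a C_{2k+1}. Summing over x gives O(n²).

Lower bound. Starting from the empty graph, add (2l+1)-cycles on vertices pairwise at distance at
least 2k+1. By `isCycle_length_eq_of_sup_map_cycleGraph` all cycles of length at most 2k+1 still
have length 2l+1. If each vertex is used at most d times, degrees stay at most 2d, and (2d+1)^(2k)
bounds the balls to avoid. With d about n^(1/(2k+2)) these are small enough for order nd cycles to
fit (`exists_graph_of_greedy_cycles`). -/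

namespace SimpleGraph

variable {V : Type*} {G : SimpleGraph V}

/-! ### Spheres and branches in graphs of large girth -/

/-- Two paths with the same ends whose total length is less than the length of every cycle
coincide. -/
lemma Walk.IsPath.eq_of_length_add_le {g : ℕ}
    (hg : ∀ (v : V) (c : G.Walk v v), c.IsCycle → g < c.length)
    {u v : V} {p q : G.Walk u v} (hp : p.IsPath) (hq : q.IsPath) (hpq : p.length + q.length ≤ g) :
    p = q := by
  by_contra h
  obtain ⟨w, -, -, c, hc, hlen⟩ := hp.exists_isCycle_length_le_add_of_ne hq h
  exact absurd (hg w c hc) (by omega)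

/-- The set of vertices joined to `x` by a path of length `l`. -/
def pathSphere (G : SimpleGraph V) (x : V) (l : ℕ) : Set V :=
  {u | ∃ p : G.Walk x u, p.IsPath ∧ p.length = l}

/-- Otherwise the proper initial segment of `p` up to `z` and a path of length `l` to `z` would be
distinct but too short together. -/
lemma eq_of_mem_pathSphere_of_mem_support {l : ℕ}
    (hg : ∀ (v : V) (c : G.Walk v v), c.IsCycle → 2 * l < c.length)
    {x u z : V} {p : G.Walk x u} (hp : p.IsPath) (hpl : p.length = l)
    (hz : z ∈ G.pathSphere x l) (hzp : z ∈ p.support) : z = u := by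
  classical
  obtain ⟨q, hq, hql⟩ := hz
  by_contra hne
  have hlt := p.length_takeUntil_lt_length hzp hne
  have := (hp.takeUntil hzp).eq_of_length_add_le hg hq (by omega)
  rw [this] at hlt
  omega

lemma snd_eq_of_mem_support_of_mem_support {l : ℕ}
    (hg : ∀ (v : V) (c : G.Walk v v), c.IsCycle → 2 * l < c.length)
    {x u w z : V} {p : G.Walk x u} (hp : p.IsPath) (hpl : p.length ≤ l)
    {q : G.Walk x w} (hq : q.IsPath) (hql : q.length ≤ l)
    (hzp : z ∈ p.support) (hzq : z ∈ q.support) (hzx : z ≠ x) : p.snd = q.snd := by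
  classical
  have h1 := p.length_takeUntil_le_length hzp
  have h2 := q.length_takeUntil_le_length hzq
  have := (hp.takeUntil hzp).eq_of_length_add_le hg (hq.takeUntil hzq) (by omega)
  rw [← p.snd_takeUntil hzx hzp, this, q.snd_takeUntil hzx hzq]

/-- Radii with different first steps meet only at `x`, and each meets the sphere only at its end, so
the two radii and `q` close up without repetition. -/
lemma exists_isCycle_of_path_in_pathSphere {l : ℕ} (hl : 2 ≤ l)
    (hg : ∀ (v : V) (c : G.Walk v v), c.IsCycle → 2 * l < c.length)
    {x u w : V} {p : G.Walk x u} (hp : p.IsPath) (hpl : p.length = l)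
    {p' : G.Walk x w} (hp' : p'.IsPath) (hpl' : p'.length = l) (hne : p.snd ≠ p'.snd)
    {q : G.Walk u w} (hq : q.IsPath) (hqs : ∀ z ∈ q.support, z ∈ G.pathSphere x l) :
    ∃ c : G.Walk x x, c.IsCycle ∧ c.length = 2 * l + q.length := by
  have hxnot : x ∉ G.pathSphere x l := by
    rintro ⟨r, hr, hrl⟩
    rw [Walk.isPath_iff_nil, ← Walk.length_eq_zero_iff] at hr
    omega
  have hw : w ∉ p'.reverse.support.tail := by
    have h := hp'.reverse.support_nodup
    rw [← p'.reverse.cons_tail_support] at h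
    exact (List.nodup_cons.1 h).1
  have hu : u ∉ q.support.tail := by
    have h := hq.support_nodup
    rw [← q.cons_tail_support] at h
    exact (List.nodup_cons.1 h).1
  have hx : x ∉ p.support.tail := by
    have h := hp.support_nodup
    rw [← p.cons_tail_support] at h
    exact (List.nodup_cons.1 h).1
  have happ : (p.append q).IsPath := by
    rw [Walk.isPath_def, Walk.support_append, List.nodup_append']
    refine ⟨hp.support_nodup, hq.support_nodup.tail, fun z hzp hzq => hu ?_⟩
    have := eq_of_mem_pathSphere_of_mem_support hg hp hpl (hqs z (List.mem_of_mem_tail hzq)) hzp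
    exact this ▸ hzq
  refine ⟨(p.append q).append p'.reverse, ?_, ?_⟩
  · refine happ.isCycle_append hp'.reverse ?_ (Or.inr (by simp; omega))
    rw [Walk.tail_support_append]
    intro z hz hz'
    have hzp' : z ∈ p'.support := by
      have := List.mem_of_mem_tail hz'
      simpa using this
    rcases List.mem_append.1 hz with hz | hz
    · refine hne (snd_eq_of_mem_support_of_mem_support hg hp hpl.le hp' hpl'.le
        (List.mem_of_mem_tail hz) hzp' ?_)
      rintro rfl
      exact hx hz
    · have := eq_of_mem_pathSphere_of_mem_support hg hp' hpl' (hqs z (List.mem_of_mem_tail hz)) hzp'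
      exact hw (this ▸ hz')
  · simp; omega

/-- In a graph of girth more than `2 * l`, a vertex of the sphere of radius `l` around `x` has at
most one neighbour in the sphere in each branch. -/
lemma eq_of_adj_of_snd_eq {l : ℕ} (hl : 2 ≤ l)
    (hg : ∀ (v : V) (c : G.Walk v v), c.IsCycle → 2 * l < c.length)
    {x y u w : V} (hy : y ∈ G.pathSphere x l) {p : G.Walk x u} (hp : p.IsPath)
    (hpl : p.length = l) {q : G.Walk x w} (hq : q.IsPath) (hql : q.length = l)
    (hsnd : p.snd = q.snd) (hu : G.Adj u y) (hw : G.Adj w y) : u = w := by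
  -- Trading the first edge of a radius for the edge to `y` keeps its length `l`. Both modified
  -- paths run from the common second vertex to `y`, hence coincide, and so do their penultimate
  -- vertices.
  have key : ∀ {u : V} (p : G.Walk x u), p.IsPath → p.length = l → ∀ hu : G.Adj u y,
      (p.tail.concat hu).IsPath ∧ (p.tail.concat hu).length = l := by
    intro u p hp hpl hu
    refine ⟨hp.tail.concat (fun h => ?_) hu, ?_⟩
    · have hnil : ¬ p.Nil := by
        rw [← Walk.length_eq_zero_iff]; omega
      rw [Walk.support_tail_of_not_nil _ hnil] at h
      exact hu.ne (eq_of_mem_pathSphere_of_mem_support hg hp hpl hy (List.mem_of_mem_tail h)).symm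
    · have hnil : ¬ p.Nil := by
        rw [← Walk.length_eq_zero_iff]; omega
      have := Walk.length_tail_add_one hnil
      simp; omega
  obtain ⟨h1, h1l⟩ := key p hp hpl hu
  obtain ⟨h2, h2l⟩ := key q hq hql hw
  have h3 : ((p.tail.concat hu).copy hsnd rfl).IsPath := by simpa using h1
  have := h3.eq_of_length_add_le hg h2 (by rw [Walk.length_copy]; omega)
  have h4 := congrArg Walk.penultimate this
  have h5 : ∀ {a b : V} (h : a = b) (r : G.Walk a y), (r.copy h rfl).penultimate = r.penultimate := by
    intro a b h r; subst h; rfl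
  rw [h5] at h4
  simpa using h4

/-! ### Edges inside a sphere -/

/-- A finite vertex set spanning many edges contains a nonempty subset of large minimum degree. -/
lemma exists_subset_forall_lt_card_adj [DecidableEq V] [DecidableRel G.Adj] (d : ℕ) (S : Finset V)
    (hS : 2 * d * S.card < ((S ×ˢ S).filter fun e => G.Adj e.1 e.2).card) :
    ∃ T ⊆ S, T.Nonempty ∧ ∀ v ∈ T, d < (T.filter (G.Adj v)).card := by
  induction S using Finset.strongInduction with
  | H S ih =>
    by_cases h : ∀ v ∈ S, d < (S.filter (G.Adj v)).card
    · refine ⟨S, subset_rfl, ?_, h⟩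
      by_contra hne
      rw [Finset.not_nonempty_iff_eq_empty] at hne
      subst hne
      simp at hS
    · push Not at h
      obtain ⟨v, hv, hd⟩ := h
      -- Edges are counted as ordered pairs, so deleting `v` loses at most `2 * d` of them and the
      -- density hypothesis survives.
      obtain ⟨T, hT, hT'⟩ := ih (S.erase v) (Finset.erase_ssubset hv) (by
        have hsub : ((S ×ˢ S).filter fun e => G.Adj e.1 e.2) ⊆
            (((S.erase v) ×ˢ (S.erase v)).filter fun e => G.Adj e.1 e.2) ∪
            ((S.filter (G.Adj v)).image (fun w => (v, w)) ∪
              (S.filter (G.Adj v)).image (fun w => (w, v))) := by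
          rintro ⟨a, b⟩ hab
          have := G.adj_comm a b
          simp only [Finset.mem_filter, Finset.mem_product, Finset.mem_union, Finset.mem_image,
            Finset.mem_erase, Prod.mk.injEq] at hab ⊢
          by_cases ha : a = v
          · subst ha
            exact Or.inr (Or.inl ⟨b, ⟨hab.1.2, hab.2⟩, rfl, rfl⟩)
          · by_cases hb : b = v
            · subst hb
              exact Or.inr (Or.inr ⟨a, ⟨hab.1.1, hab.2.symm⟩, rfl, rfl⟩)
            · exact Or.inl ⟨⟨⟨ha, hab.1.1⟩, hb, hab.1.2⟩, hab.2⟩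
        have h1 := Finset.card_le_card hsub
        have h2 := Finset.card_union_le
          (((S.erase v) ×ˢ (S.erase v)).filter fun e => G.Adj e.1 e.2)
          ((S.filter (G.Adj v)).image (fun w => (v, w)) ∪
              (S.filter (G.Adj v)).image (fun w => (w, v)))
        have h3 := Finset.card_union_le ((S.filter (G.Adj v)).image (fun w => (v, w)))
          ((S.filter (G.Adj v)).image (fun w => (w, v)))
        have h4 : ((S.filter (G.Adj v)).image (fun w => (v, w))).card ≤ _ := Finset.card_image_le
        have h5 : ((S.filter (G.Adj v)).image (fun w => (w, v))).card ≤ _ := Finset.card_image_le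
        have h6 := Finset.card_erase_add_one hv
        rw [← h6] at hS
        linarith)
      exact ⟨T, hT.trans (Finset.erase_subset _ _), hT'⟩

/-- In a vertex set of minimum degree more than `d`, every vertex ends a path of each length up to
`d`. -/
lemma exists_isPath_of_forall_lt_card_adj [DecidableEq V] [DecidableRel G.Adj] {d : ℕ} {T : Finset V}
    (hT : ∀ v ∈ T, d < (T.filter (G.Adj v)).card) {w : V} (hw : w ∈ T) {m : ℕ} (hm : m ≤ d) :
    ∃ (u : V) (q : G.Walk u w), q.IsPath ∧ q.length = m ∧ ∀ z ∈ q.support, z ∈ T := by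
  induction m with
  | zero => exact ⟨w, .nil, by simp, rfl, by simpa using hw⟩
  | succ m ih =>
    obtain ⟨u, q, hq, hql, hqT⟩ := ih (by omega)
    have hu := hT u (hqT u q.start_mem_support)
    have hcard : q.support.toFinset.card ≤ m + 1 :=
      (List.toFinset_card_le _).trans (by simp [hql])
    obtain ⟨z, hz, hzq⟩ := Finset.exists_mem_notMem_of_card_lt_card
      (s := q.support.toFinset.erase u) (t := T.filter (G.Adj u)) (by
        have := Finset.card_erase_le (s := q.support.toFinset) (a := u)
        rw [Finset.card_erase_of_mem (by simp)]
        omega)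
    rw [Finset.mem_filter] at hz
    have hzq' : z ∉ q.support := fun h => hzq (by simp [h, hz.2.ne'])
    refine ⟨z, .cons hz.2.symm q, hq.cons hzq', by simp [hql], ?_⟩
    intro y hy
    rw [Walk.support_cons, List.mem_cons] at hy
    rcases hy with rfl | hy
    · exact hz.1
    · exact hqT y hy

/-- If `G` has girth more than `2 * l` and no cycle of length `2 * l + m`, then the sphere of radius
`l` around a vertex spans only linearly many edges. -/
lemma card_adj_pathSphere_le [Fintype V] [DecidableEq V] [DecidableRel G.Adj] {l m : ℕ} (hl : 2 ≤ l)
    (hm : 0 < m) (hg : ∀ (v : V) (c : G.Walk v v), c.IsCycle → 2 * l < c.length)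
    (hcyc : ∀ (v : V) (c : G.Walk v v), c.IsCycle → c.length ≠ 2 * l + m) (x : V)
    (S : Finset V) (hS : ∀ u ∈ S, u ∈ G.pathSphere x l) :
    ((S ×ˢ S).filter fun e => G.Adj e.1 e.2).card ≤ 2 * (m + 1) * S.card := by
  by_contra! h
  obtain ⟨T, hTS, ⟨w, hw⟩, hT⟩ := exists_subset_forall_lt_card_adj (m + 1) S h
  obtain ⟨u, q, hq, hql, hqT⟩ := exists_isPath_of_forall_lt_card_adj hT hw
    (m := m - 1) (by omega)
  have hT' : ∀ z ∈ T, z ∈ G.pathSphere x l := fun z hz => hS z (hTS hz)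
  have huT := hqT u q.start_mem_support
  obtain ⟨pw, hpw, hpwl⟩ := hT' w hw
  -- Of the at least `m + 2` neighbours of `u` in `T`, at least two avoid the `m` vertices of `q`,
  -- and at most one neighbour lies in the branch of `w`. Prepending `z` brings the path to length
  -- `m`.
  obtain ⟨z, hz, hzq, hbr⟩ : ∃ z ∈ T.filter (G.Adj u), z ∉ q.support ∧
      ∀ p : G.Walk x z, p.IsPath → p.length = l → p.snd ≠ pw.snd := by
    by_contra! hcon
    classical
    let B := (T.filter (G.Adj u)).filter fun z => z ∉ q.support
    have hB : 1 < B.card := by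
      have h1 := Finset.card_filter_add_card_filter_not (s := T.filter (G.Adj u))
        (fun z => z ∈ q.support)
      have h2 : ((T.filter (G.Adj u)).filter fun z => z ∈ q.support).card ≤ m := by
        refine (Finset.card_le_card (t := q.support.toFinset) ?_).trans
          ((List.toFinset_card_le _).trans (by simp; omega))
        intro y hy
        simpa using (Finset.mem_filter.1 hy).2
      have h3 := hT u huT
      have h4 : B.card = ((T.filter (G.Adj u)).filter fun z => ¬ z ∈ q.support).card := rfl
      omega
    obtain ⟨a, ha, b, hb, hab⟩ := Finset.one_lt_card.1 hB
    simp only [B, Finset.mem_filter] at ha hb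
    obtain ⟨p, hp, hpl, hps⟩ := hcon a (by simp [ha]) ha.2
    obtain ⟨p', hp', hpl', hps'⟩ := hcon b (by simp [hb]) hb.2
    exact hab (eq_of_adj_of_snd_eq hl hg (hT' u huT) hp hpl hp' hpl' (hps.trans hps'.symm)
      ha.1.2.symm hb.1.2.symm)
  rw [Finset.mem_filter] at hz
  obtain ⟨p, hp, hpl⟩ := hT' z hz.1
  obtain ⟨c, hc, hcl⟩ := exists_isCycle_of_path_in_pathSphere hl hg hp hpl hpw hpwl (hbr p hp hpl)
    (q := .cons hz.2.symm q) (hq.cons hzq) (by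
      intro y hy
      rw [Walk.support_cons, List.mem_cons] at hy
      rcases hy with rfl | hy
      · exact hT' _ hz.1
      · exact hT' y (hqT y hy))
  refine hcyc x c hc ?_
  rw [hcl, Walk.length_cons, hql]
  omega

/-! ### Counting (2l+1)-cycles from above -/

/-- A sequence of distinct, consecutively adjacent vertices is the support of a path. -/
lemma exists_isPath_support_eq_map_range {n : ℕ} {f : ℕ → V}
    (hadj : ∀ i < n, G.Adj (f i) (f (i + 1))) (hf : Set.InjOn f (Set.Iic n)) :
    ∃ p : G.Walk (f 0) (f n), p.IsPath ∧ p.length = n ∧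
      p.support = (List.range (n + 1)).map f := by
  suffices h : ∃ p : G.Walk (f 0) (f n), p.length = n ∧ p.support = (List.range (n + 1)).map f by
    obtain ⟨p, hp, hs⟩ := h
    refine ⟨p, ?_, hp, hs⟩
    rw [Walk.isPath_def, hs]
    refine List.Nodup.map_on (fun i hi j hj hij => hf ?_ ?_ hij) List.nodup_range
    · simp at hi; simp; omega
    · simp at hj; simp; omega
  clear hf
  induction n with
  | zero => exact ⟨.nil, rfl, by simp⟩
  | succ n ih =>
    obtain ⟨p, hp, hs⟩ := ih fun i hi => hadj i (by omega)
    refine ⟨p.concat (hadj n (by omega)), by simp [hp], ?_⟩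
    rw [Walk.support_concat, hs, List.range_succ (n := n + 1), List.map_append]
    simp

/-- A labelled copy of a cycle, as a periodic sequence of vertices. -/
lemma Copy.exists_periodic {n : ℕ} (hn : 2 ≤ n) (f : Copy (cycleGraph n) G) :
    ∃ F : ℕ → V, (∀ i, G.Adj (F i) (F (i + 1))) ∧
      (∀ i j, F i = F j → i % n = j % n) ∧ F n = F 0 ∧ ∀ i (hi : i < n), F i = f ⟨i, hi⟩ := by
  refine ⟨fun i => f ⟨i % n, Nat.mod_lt _ (by omega)⟩, fun i => f.toHom.map_adj ?_,
    fun i j h => by simpa using f.injective h, by simp, fun i hi => by simp [Nat.mod_eq_of_lt hi]⟩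
  rw [cycleGraph_adj', Fin.val_sub, Fin.val_sub]
  right
  have h1 : (i + 1) % n = (i % n + 1) % n := by simp
  have h2 : i % n < n := Nat.mod_lt _ (by omega)
  simp only [h1]
  rcases Nat.lt_or_ge (i % n + 1) n with h | h
  · rw [Nat.mod_eq_of_lt h, show n - i % n + (i % n + 1) = 1 + n by omega, Nat.add_mod_right,
      Nat.mod_eq_of_lt (by omega)]
  · rw [show i % n + 1 = n by omega, Nat.mod_self, show n - i % n + 0 = 1 by omega,
      Nat.mod_eq_of_lt (by omega)]

lemma labelledCopyCount_eq_natCard {W : Type*} [Fintype V] [Fintype W] (G : SimpleGraph V)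
    (H : SimpleGraph W) : G.labelledCopyCount H = Nat.card (Copy H G) := by
  classical
  rw [labelledCopyCount, Nat.card_eq_fintype_card]

lemma labelledCopyCount_cycleGraph_le [Fintype V] {l m : ℕ} (hl : 2 ≤ l)
    (hm : 0 < m) (hg : ∀ (v : V) (c : G.Walk v v), c.IsCycle → 2 * l < c.length)
    (hcyc : ∀ (v : V) (c : G.Walk v v), c.IsCycle → c.length ≠ 2 * l + m) :
    G.labelledCopyCount (cycleGraph (2 * l + 1)) ≤ 2 * (m + 1) * Fintype.card V ^ 2 := by
  classical
  choose F hFadj hFinj hFper hF using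
    fun f : Copy (cycleGraph (2 * l + 1)) G => f.exists_periodic (by omega)
  have hP : ∀ f, ∃ p : G.Walk (F f 0) (F f l), p.IsPath ∧ p.length = l ∧
      p.support = (List.range (l + 1)).map (F f) := by
    intro f
    refine exists_isPath_support_eq_map_range (fun i _ => hFadj f i) fun i hi j hj hij => ?_
    have := hFinj f i j hij
    simp only [Set.mem_Iic] at hi hj
    rwa [Nat.mod_eq_of_lt (by omega), Nat.mod_eq_of_lt (by omega)] at this
  -- The other radius, traversed backwards from `F f (2 * l + 1) = F f 0`.
  have hQ : ∀ f, ∃ p : G.Walk (F f 0) (F f (l + 1)), p.IsPath ∧ p.length = l ∧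
      p.support = (List.range (l + 1)).map (fun i => F f (2 * l + 1 - i)) := by
    intro f
    have := exists_isPath_support_eq_map_range (G := G) (n := l) (f := fun i => F f (2 * l + 1 - i))
      (fun i hi => by
        have := hFadj f (2 * l + 1 - (i + 1))
        rw [show 2 * l + 1 - (i + 1) + 1 = 2 * l + 1 - i by omega] at this
        exact this.symm) (fun i hi j hj hij => by
        have := hFinj f _ _ hij
        simp only [Set.mem_Iic] at hi hj
        rcases Nat.eq_zero_or_pos i with rfl | hi0 <;> rcases Nat.eq_zero_or_pos j with rfl | hj0
        · rfl
        · rw [Nat.sub_zero, Nat.mod_self, Nat.mod_eq_of_lt (by omega)] at this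
          omega
        · rw [Nat.sub_zero, Nat.mod_self, Nat.mod_eq_of_lt (by omega)] at this
          omega
        · rw [Nat.mod_eq_of_lt (by omega), Nat.mod_eq_of_lt (by omega)] at this
          omega)
    obtain ⟨p, hp, hpl, hps⟩ := this
    exact ⟨p.copy (by simp [hFper]) (by congr 1; omega), by simpa using hp, by simpa using hpl,
      by simpa using hps⟩
  let S : V → Finset V := fun x => Finset.univ.filter (· ∈ G.pathSphere x l)
  let E : Finset (Σ _ : V, V × V) := (Finset.univ : Finset V).sigma
    fun x => (S x ×ˢ S x).filter fun e : V × V => G.Adj e.1 e.2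
  have hE : E.card ≤ 2 * (m + 1) * Fintype.card V ^ 2 := by
    rw [Finset.card_sigma]
    refine (Finset.sum_le_card_nsmul _ _ (2 * (m + 1) * Fintype.card V) fun x _ => ?_).trans ?_
    · refine (card_adj_pathSphere_le hl hm hg hcyc x (S x) (by simp [S])).trans ?_
      exact Nat.mul_le_mul_left _ (Finset.card_le_univ _)
    · rw [Finset.card_univ, smul_eq_mul]
      apply le_of_eq; ring
  refine le_trans ?_ hE
  have hmem : ∀ f, (⟨F f 0, F f l, F f (l + 1)⟩ : Σ _ : V, V × V) ∈ E := by
    intro f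
    obtain ⟨p, hp, hpl, -⟩ := hP f
    obtain ⟨q, hq, hql, -⟩ := hQ f
    simp only [E, S, Finset.mem_sigma, Finset.mem_filter, Finset.mem_product,
      Finset.mem_univ, true_and]
    exact ⟨⟨⟨p, hp, hpl⟩, q, hq, hql⟩, hFadj f l⟩
  have hinj : Function.Injective fun f => (⟨⟨F f 0, F f l, F f (l + 1)⟩, hmem f⟩ : E) := by
    intro f g hfg
    simp only [Subtype.mk.injEq, Sigma.mk.injEq, heq_eq_eq, Prod.mk.injEq] at hfg
    obtain ⟨h0, h1, h2⟩ := hfg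
    have key : ∀ {a b a' b' : V} (p : G.Walk a b) (q : G.Walk a' b'), a = a' → b = b' → p.IsPath →
        q.IsPath → p.length = l → q.length = l → p.support = q.support := by
      rintro a b _ _ p q rfl rfl hp hq hpl hql
      rw [hp.eq_of_length_add_le hg hq (by omega)]
    obtain ⟨p, hp, hpl, hps⟩ := hP f
    obtain ⟨q, hq, hql, hqs⟩ := hQ f
    obtain ⟨p', hp', hpl', hps'⟩ := hP g
    obtain ⟨q', hq', hql', hqs'⟩ := hQ g
    have e1 := key p p' h0 h1 hp hp' hpl hpl'
    have e2 := key q q' h0 h2 hq hq' hql hql'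
    rw [hps, hps', List.map_inj_left] at e1
    rw [hqs, hqs', List.map_inj_left] at e2
    ext ⟨i, hi⟩
    rw [← hF, ← hF]
    rcases Nat.lt_or_ge i (l + 1) with h | h
    · exact e1 i (by simpa using h)
    · have := e2 (2 * l + 1 - i) (by simp; omega)
      simpa [show 2 * l + 1 - (2 * l + 1 - i) = i by omega] using this
  have := Nat.card_le_card_of_injective _ hinj
  rwa [Nat.card_eq_fintype_card (α := E), Fintype.card_coe, ← labelledCopyCount_eq_natCard] at this

end SimpleGraph

/-! ### Short cycles after adding a cycle -/

namespace SimpleGraph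

variable {V : Type*} {G : SimpleGraph V}

/-- The vertices of a closed walk which is a cycle, as a periodic sequence. -/
lemma Walk.IsCycle.exists_periodic {v : V} {c : G.Walk v v} (hc : c.IsCycle) :
    ∃ w : ℕ → V, (∀ i, G.Adj (w i) (w (i + 1))) ∧
      (∀ i j, w i = w j → i % c.length = j % c.length) ∧ (∀ i, w (i + c.length) = w i) ∧
      ∀ e ∈ c.edges, ∃ i, e = s(w i, w (i + 1)) := by
  have h3 := hc.three_le_length
  have hend : c.getVert c.length = c.getVert 0 := by simp
  have hsucc : ∀ i, c.getVert ((i + 1) % c.length) = c.getVert (i % c.length + 1) := by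
    intro i
    have h2 : i % c.length < c.length := Nat.mod_lt _ (by omega)
    rw [show (i + 1) % c.length = (i % c.length + 1) % c.length by simp]
    rcases Nat.lt_or_ge (i % c.length + 1) c.length with h | h
    · rw [Nat.mod_eq_of_lt h]
    · rw [show i % c.length + 1 = c.length by omega, Nat.mod_self, hend]
  refine ⟨fun i => c.getVert (i % c.length), fun i => ?_, fun i j h => ?_, fun i => by simp,
    fun e he => ?_⟩
  · simp only [hsucc]
    exact c.adj_getVert_succ (Nat.mod_lt _ (by omega))
  · have hi : i % c.length < c.length := Nat.mod_lt _ (by omega)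
    have hj : j % c.length < c.length := Nat.mod_lt _ (by omega)
    exact hc.getVert_injOn' (by simp; omega) (by simp; omega) h
  · obtain ⟨i, hi, rfl⟩ := List.mem_iff_getElem.1 he
    rw [Walk.length_edges] at hi
    refine ⟨i, ?_⟩
    simp only [hsucc, Nat.mod_eq_of_lt hi]
    rw [Walk.getElem_edges]

/-- Every cycle in a cycle graph runs through all its vertices. -/
lemma length_eq_of_periodic_cycleGraph {n a : ℕ} (ha : 3 ≤ a) {u : ℕ → Fin (n + 2)}
    (hadj : ∀ i, (cycleGraph (n + 2)).Adj (u i) (u (i + 1)))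
    (hinj : ∀ i j, u i = u j → i % a = j % a) (hper : u a = u 0) : a = n + 2 := by
  let z : ℕ → ZMod (n + 2) := u
  have hstep : ∀ i, z (i + 1) - z i = 1 ∨ z (i + 1) - z i = -1 := by
    intro i
    rcases cycleGraph_adj.1 (hadj i) with h | h
    · have h' : z i - z (i + 1) = 1 := h
      right
      rw [← h']; ring
    · exact Or.inl h
  -- A change of direction would revisit a vertex after two steps, impossible when `3 ≤ a`; so the
  -- sequence is an arithmetic progression with difference `1` or `-1`.
  have hconst : ∀ i, z (i + 2) - z (i + 1) = z (i + 1) - z i := by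
    intro i
    by_contra hne
    have h0 : z (i + 2) = z i := by
      rcases hstep i with h1 | h1 <;> rcases hstep (i + 1) with h2 | h2
      · exact absurd (h2.trans h1.symm) hne
      · linear_combination h1 + h2
      · linear_combination h1 + h2
      · exact absurd (h2.trans h1.symm) hne
    have h1 : (i + 2) % a = i % a := hinj _ _ h0
    have h2 : a ∣ i + 2 - i := (Nat.modEq_iff_dvd' (by omega)).1 h1.symm
    have := Nat.le_of_dvd (by omega) h2
    omega
  obtain ⟨δ, hδ, hlin⟩ : ∃ δ : ZMod (n + 2), (δ = 1 ∨ δ = -1) ∧ ∀ i, z (i + 1) - z i = δ := by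
    refine ⟨z 1 - z 0, hstep 0, fun i => ?_⟩
    induction i with
    | zero => rfl
    | succ i ih => rw [← ih]; exact hconst i
  have hz : ∀ i : ℕ, z i = z 0 + i * δ := by
    intro i
    induction i with
    | zero => simp
    | succ i ih => push_cast; linear_combination hlin i + ih
  apply Nat.dvd_antisymm
  · have h1 : z (n + 2) = z 0 := by
      rw [hz]; simp
    have h2 : (n + 2) % a = 0 % a := hinj _ _ h1
    rw [Nat.zero_mod] at h2
    exact Nat.dvd_of_mod_eq_zero h2
  · have h1 : z a = z 0 := hper
    rw [hz] at h1
    have h2 : (a : ZMod (n + 2)) = 0 := by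
      rcases hδ with rfl | rfl
      · simpa using h1
      · simpa using h1
    exact (ZMod.natCast_eq_zero_iff _ _).1 h2

/-- Adding a cycle through vertices that are far apart creates no other short cycle. -/
lemma isCycle_length_eq_of_sup_map_cycleGraph {n g : ℕ}
    (hG : ∀ (v : V) (c : G.Walk v v), c.IsCycle → c.length ≤ g → c.length = n + 2)
    (f : Fin (n + 2) ↪ V)
    (hf : ∀ i j, ∀ p : G.Walk (f i) (f j), p.length < g → i = j)
    {C : SimpleGraph V} (hC : C = (cycleGraph (n + 2)).map f)
    (v : V) (c : (G ⊔ C).Walk v v) (hc : c.IsCycle) (hcg : c.length ≤ g) :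
    c.length = n + 2 := by
  have h3 := hc.three_le_length
  obtain ⟨w, hadj, hinj, hper, hedge⟩ := hc.exists_periodic
  have hor : ∀ i, ¬ C.Adj (w i) (w (i + 1)) → G.Adj (w i) (w (i + 1)) := fun i hi =>
    (hadj i).resolve_right hi
  by_cases hall : ∀ i, C.Adj (w i) (w (i + 1))
  · have : ∀ i, ∃ u, f u = w i := by
      intro i
      obtain ⟨u, u', -, hu, -⟩ := (map_adj f _ _ _).1 (hC ▸ hall i)
      exact ⟨u, hu⟩
    choose u hu using this
    refine length_eq_of_periodic_cycleGraph h3 (u := u) (fun i => ?_) (fun i j hij => ?_) ?_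
    · have := hall i
      rwa [← hu, ← hu, hC, map_adj_apply] at this
    · exact hinj i j (by rw [← hu, ← hu, hij])
    · apply f.injective
      rw [hu, hu]
      simpa using hper 0
  by_cases hnone : ∀ i, G.Adj (w i) (w (i + 1))
  · have hG' : ∀ e ∈ c.edges, e ∈ G.edgeSet := by
      intro e he
      obtain ⟨i, rfl⟩ := hedge e he
      exact hnone i
    rw [← Walk.length_transfer c hG']
    exact hG v _ (hc.transfer hG') (by simpa using hcg)
  exfalso
  push Not at hall hnone
  obtain ⟨j, hj⟩ := hall
  obtain ⟨i, hi⟩ := hnone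
  have hi : C.Adj (w i) (w (i + 1)) := by
    by_contra h
    exact hi (hor i h)
  have hperm : ∀ m i, w (i + m * c.length) = w i := by
    intro m
    induction m with
    | zero => simp
    | succ m ih => intro i; rw [Nat.succ_mul, ← add_assoc, hper, ih]
  -- In the mixed case, a maximal run of non-`C` edges between two `C`-edges is a walk in `G` of
  -- length `t < g` joining vertices of the added cycle. By `hf` its ends agree, yet `0 < t <
  -- c.length`.
  obtain ⟨s, hs, hs'⟩ : ∃ s, C.Adj (w s) (w (s + 1)) ∧ ¬ C.Adj (w (s + 1)) (w (s + 2)) := by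
    by_contra! hcon
    have hfrom : ∀ m, C.Adj (w (i + m)) (w (i + m + 1)) := by
      intro m
      induction m with
      | zero => exact hi
      | succ m ih => exact hcon _ ih
    -- Shifting `j` by `i` periods moves it past `i`.
    have hle : i ≤ i * c.length := Nat.le_mul_of_pos_right _ (by omega)
    have := hfrom (j + i * c.length - i)
    rw [show i + (j + i * c.length - i) = j + i * c.length by omega, hperm,
      show j + i * c.length + 1 = j + 1 + i * c.length by omega, hperm] at this
    exact hj this
  have hexists : ∃ t, C.Adj (w (s + 1 + t)) (w (s + 1 + t + 1)) := by
    refine ⟨c.length - 1, ?_⟩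
    rw [show s + 1 + (c.length - 1) = s + c.length by omega, hper,
      show s + c.length + 1 = s + 1 + c.length by omega, hper]
    exact hs
  classical
  set t := Nat.find hexists with ht
  have htadj : C.Adj (w (s + 1 + t)) (w (s + 1 + t + 1)) := Nat.find_spec hexists
  have htmin : ∀ m < t, ¬ C.Adj (w (s + 1 + m)) (w (s + 1 + m + 1)) := fun m hm =>
    Nat.find_min hexists hm
  have ht0 : t ≠ 0 := by
    intro h0
    rw [h0] at htadj
    exact hs' htadj
  have htlt : t < c.length := by
    by_contra! hge
    refine htmin (c.length - 1) (by omega) ?_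
    rw [show s + 1 + (c.length - 1) = s + c.length by omega, hper,
      show s + c.length + 1 = s + 1 + c.length by omega, hper]
    exact hs
  obtain ⟨p, hp⟩ : ∃ p : G.Walk (w (s + 1)) (w (s + 1 + t)), p.length = t := by
    clear_value t
    clear ht htadj ht0 htlt
    induction t with
    | zero => exact ⟨.nil, rfl⟩
    | succ t ih =>
      obtain ⟨p, hp⟩ := ih fun m hm => htmin m (by omega)
      exact ⟨p.concat (hor _ (htmin t (by omega))), by simp [hp]⟩
  obtain ⟨-, b, -, -, hb⟩ := (map_adj f _ _ _).1 (hC ▸ hs)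
  obtain ⟨d, -, -, hd, -⟩ := (map_adj f _ _ _).1 (hC ▸ htadj)
  have hbd := hf b d (p.copy hb.symm hd.symm) (by simp; omega)
  have h1 := hinj (s + 1) (s + 1 + t) (by rw [← hb, ← hd, hbd])
  have h2 : c.length ∣ s + 1 + t - (s + 1) := (Nat.modEq_iff_dvd' (by omega)).1 h1
  have := Nat.le_of_dvd (by omega) h2
  omega

/-! ### Greedy packing -/

/-- In a graph of maximum degree at most `D`, at most `(D + 1) ^ j` vertices are joined to a given
vertex by a walk of length at most `j`. -/
lemma exists_card_le_of_walk_length_le [Fintype V] [DecidableEq V] [DecidableRel G.Adj] {D : ℕ}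
    (hD : ∀ v, G.degree v ≤ D) (v : V) (j : ℕ) :
    ∃ B : Finset V, B.card ≤ (D + 1) ^ j ∧ ∀ u, ∀ p : G.Walk u v, p.length ≤ j → u ∈ B := by
  induction j with
  | zero =>
    refine ⟨{v}, by simp, fun u p hp => ?_⟩
    have := Walk.eq_of_length_eq_zero (by omega : p.length = 0)
    simp [this]
  | succ j ih =>
    obtain ⟨B, hB, hBm⟩ := ih
    refine ⟨B.biUnion fun u => insert u (G.neighborFinset u), ?_, fun u p hp => ?_⟩
    · refine Finset.card_biUnion_le.trans ?_
      refine (Finset.sum_le_card_nsmul _ _ (D + 1) fun u _ => ?_).trans ?_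
      · refine (Finset.card_insert_le _ _).trans ?_
        simpa using hD u
      · rw [smul_eq_mul, pow_succ]
        exact Nat.mul_le_mul_right _ hB
    · rw [Finset.mem_biUnion]
      cases p with
      | nil => exact ⟨_, hBm _ .nil (by simp), by simp⟩
      | cons h q =>
        refine ⟨_, hBm _ q (by simpa using hp), ?_⟩
        simp [h.symm]

/-- Greedy choice of elements that are pairwise unrelated. -/
lemma exists_subset_card_eq_pairwise {α : Type*} [DecidableEq α] {R : α → α → Prop} {b : ℕ}
    (hb : 0 < b) (hsymm : ∀ u v, R u v → R v u)
    (hR : ∀ v, ∃ B : Finset α, B.card ≤ b ∧ ∀ u, R u v → u ∈ B) (hrefl : ∀ v, R v v)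
    (L : Finset α) (r : ℕ) (hL : r * b ≤ L.card) :
    ∃ T ⊆ L, T.card = r ∧ ∀ u ∈ T, ∀ v ∈ T, R u v → u = v := by
  choose B hB hBm using hR
  induction r with
  | zero => exact ⟨∅, by simp, rfl, by simp⟩
  | succ r ih =>
    obtain ⟨T, hTL, hTr, hT⟩ := ih (le_trans (Nat.mul_le_mul_right _ (by omega)) hL)
    have hcard : (T.biUnion B).card < L.card := by
      refine lt_of_le_of_lt (Finset.card_biUnion_le.trans
        (Finset.sum_le_card_nsmul _ _ b fun u _ => hB u)) ?_
      rw [hTr, smul_eq_mul]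
      rw [Nat.succ_mul] at hL
      omega
    obtain ⟨x, hxL, hx⟩ := Finset.exists_mem_notMem_of_card_lt_card hcard
    have hxR : ∀ v ∈ T, ¬ R x v := fun v hv h => hx (Finset.mem_biUnion.2 ⟨v, hv, hBm v x h⟩)
    refine ⟨insert x T, ?_, ?_, ?_⟩
    · exact Finset.insert_subset hxL hTL
    · rw [Finset.card_insert_of_notMem (fun h => hxR x h (hrefl x)), hTr]
    · intro u hu v hv huv
      rw [Finset.mem_insert] at hu hv
      rcases hu with rfl | hu <;> rcases hv with rfl | hv
      · rfl
      · exact absurd huv (hxR v hv)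
      · exact absurd (hsymm _ _ huv) (hxR u hu)
      · exact hT u hu v hv huv

/-- A family of graphs on `V` that are images of `H` and lie below `G` bounds the number of copies
of `H` in `G` from below. -/
lemma card_le_copyCount {W : Type*} [Fintype V] {H : SimpleGraph W} {A : Finset (SimpleGraph V)}
    (hA : ∀ C ∈ A, C ≤ G ∧ ∃ f : W ↪ V, C = H.map f) : A.card ≤ G.copyCount H := by
  classical
  have : ∀ C ∈ A, ∃ G' : G.Subgraph, Nonempty (H ≃g G'.coe) ∧ G'.spanningCoe = C := by
    intro C hC
    obtain ⟨hle, f, rfl⟩ := hA C hC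
    let φ : Copy H G := ⟨⟨f, fun {a b} h => hle (by simpa using h)⟩, f.injective⟩
    refine ⟨φ.toSubgraph, ⟨φ.isoToSubgraph⟩, ?_⟩
    ext a b
    rw [map_adj]
    simp [φ, Relation.Map]
  choose! S hS hSC using this
  rw [copyCount]
  refine Finset.card_le_card_of_injOn S (fun C hC => by simpa using hS C hC) ?_
  intro C hC C' hC' h
  rw [← hSC C hC, ← hSC C' hC', h]

lemma degree_sup_map_cycleGraph_le [DecidableEq V] {n : ℕ} (f : Fin (n + 2) ↪ V) (v : V)
    [Fintype (G.neighborSet v)] [Fintype ((G ⊔ (cycleGraph (n + 2)).map f).neighborSet v)] :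
    (G ⊔ (cycleGraph (n + 2)).map f).degree v ≤
      G.degree v + if v ∈ Finset.univ.map f then 2 else 0 := by
  split_ifs with h
  · obtain ⟨i, -, rfl⟩ := Finset.mem_map.1 h
    have hsub : (G ⊔ (cycleGraph (n + 2)).map f).neighborFinset (f i) ⊆
        G.neighborFinset (f i) ∪ {f (i - 1), f (i + 1)} := by
      intro u hu
      rw [mem_neighborFinset, sup_adj, map_adj] at hu
      rw [Finset.mem_union, mem_neighborFinset]
      rcases hu with hu | ⟨a, b, hab, ha, rfl⟩
      · exact Or.inl hu
      · obtain rfl := f.injective ha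
        have : b ∈ (cycleGraph (n + 2)).neighborSet a := hab
        rw [cycleGraph_neighborSet] at this
        right
        rcases this with rfl | rfl <;> simp
    refine (Finset.card_le_card hsub).trans ((Finset.card_union_le _ _).trans ?_)
    exact Nat.add_le_add_left Finset.card_le_two _
  · refine Finset.card_le_card fun u hu => ?_
    rw [mem_neighborFinset, sup_adj, map_adj] at hu
    rw [mem_neighborFinset]
    rcases hu with hu | ⟨a, b, -, ha, -⟩
    · exact hu
    · exact absurd (Finset.mem_map.2 ⟨a, Finset.mem_univ _, ha⟩) h

/-- Greedy packing of cycles of length `n + 2` without creating any other cycle of length at most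
`g`. -/
lemma exists_graph_of_greedy_cycles [Fintype V] {n g d : ℕ} (hg : 1 < g)
    (hcard : 2 * ((n + 2) * (2 * d + 1) ^ (g - 1)) ≤ Fintype.card V) (t : ℕ)
    (ht : 2 * (n + 2) * t ≤ Fintype.card V * d) :
    ∃ G : SimpleGraph V,
      (∀ (v : V) (c : G.Walk v v), c.IsCycle → c.length ≤ g → c.length = n + 2) ∧
      t ≤ G.copyCount (cycleGraph (n + 2)) := by
  classical
  suffices h : ∃ G : SimpleGraph V,
      (∀ (v : V) (c : G.Walk v v), c.IsCycle → c.length ≤ g → c.length = n + 2) ∧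
      -- `u v` counts the chosen cycles through `v`; its sum limits how many vertices can reach the
      -- cap `d`.
      (∃ u : V → ℕ, (∀ v, G.degree v ≤ 2 * u v) ∧ (∀ v, u v ≤ d) ∧ ∑ v, u v = (n + 2) * t) ∧
      ∃ A : Finset (SimpleGraph V), A.card = t ∧
        ∀ C ∈ A, C ≤ G ∧ ∃ f : Fin (n + 2) ↪ V, C = (cycleGraph (n + 2)).map f by
    obtain ⟨G, hG, -, A, rfl, hA⟩ := h
    exact ⟨G, hG, card_le_copyCount hA⟩
  induction t with
  | zero =>
    refine ⟨⊥, fun v c hc => ?_, ⟨0, by simp, by simp, by simp⟩, ∅, rfl, by simp⟩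
    exact absurd hc (isAcyclic_bot c)
  | succ t ih =>
    obtain ⟨G, hG, ⟨u, hdeg, hud, hsum⟩, A, hAt, hA⟩ := ih (by
      refine le_trans ?_ ht
      gcongr; omega)
    have hd : 0 < d := by
      by_contra h0
      have : d = 0 := by omega
      subst this
      rw [Nat.mul_zero, Nat.le_zero, Nat.mul_eq_zero] at ht
      omega
    let L : Finset V := Finset.univ.filter fun v => u v < d
    -- By `ht`, at most half of the vertices are saturated, so the unsaturated half leaves room for
    -- the greedy choice.
    have hLcard : (n + 2) * (2 * d + 1) ^ (g - 1) ≤ L.card := by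
      have h1 := Finset.card_filter_add_card_filter_not (s := (Finset.univ : Finset V))
        (fun v => u v < d)
      rw [Finset.card_univ] at h1
      have h2 : (Finset.univ.filter fun v => ¬ u v < d).card * d ≤ (n + 2) * t := by
        rw [← hsum]
        refine (Finset.card_nsmul_le_sum _ _ d fun v hv => ?_).trans
          (Finset.sum_le_sum_of_subset (Finset.subset_univ _))
        simpa using hv
      have h3 : 2 * (Finset.univ.filter fun v => ¬ u v < d).card ≤ Fintype.card V := by
        refine Nat.le_of_mul_le_mul_right ?_ hd
        nlinarith
      have h4 : L.card = (Finset.univ.filter fun v => u v < d).card := rfl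
      omega
    obtain ⟨T, hTL, hTcard, hT⟩ := exists_subset_card_eq_pairwise
      (R := fun a b => ∃ p : G.Walk a b, p.length ≤ g - 1) (b := (2 * d + 1) ^ (g - 1))
      (by positivity)
      (fun a b ⟨p, hp⟩ => ⟨p.reverse, by simpa using hp⟩)
      (fun v => by
        obtain ⟨B, hB, hBm⟩ := exists_card_le_of_walk_length_le
          (fun v => (hdeg v).trans (Nat.mul_le_mul_left 2 (hud v))) v (g - 1)
        exact ⟨B, hB, fun u ⟨p, hp⟩ => hBm u p hp⟩)
      (fun v => ⟨.nil, by simp⟩) L (n + 2) hLcard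
    let f : Fin (n + 2) ↪ V := (T.equivFinOfCardEq hTcard).symm.toEmbedding.trans
      (Function.Embedding.subtype _)
    have hfT : ∀ i, f i ∈ T := fun i => ((T.equivFinOfCardEq hTcard).symm i).2
    have hff : ∀ i j, ∀ p : G.Walk (f i) (f j), p.length < g → i = j := fun i j p hp =>
      f.injective (hT _ (hfT i) _ (hfT j) ⟨p, by omega⟩)
    have hadj : (cycleGraph (n + 2)).Adj 0 1 := by
      rw [cycleGraph_adj]; simp
    -- The new cycle differs from all earlier ones, since its adjacent vertices are not adjacent in
    -- `G`.
    have hnle : ¬ (cycleGraph (n + 2)).map f ≤ G := by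
      intro hle
      have h1 : G.Adj (f 0) (f 1) := hle (by simpa using hadj)
      exact hadj.ne (hff 0 1 h1.toWalk (by simpa using hg))
    refine ⟨G ⊔ (cycleGraph (n + 2)).map f,
      isCycle_length_eq_of_sup_map_cycleGraph hG f hff rfl,
      ⟨fun v => u v + if v ∈ Finset.univ.map f then 1 else 0, fun v => ?_, fun v => ?_, ?_⟩,
      insert ((cycleGraph (n + 2)).map f) A, ?_, fun C hC => ?_⟩
    · have h1 := @degree_sup_map_cycleGraph_le V G _ n f v _
        inferInstance
      have h2 := hdeg v
      refine le_trans (le_of_eq (by congr!)) (h1.trans ?_)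
      dsimp only
      split_ifs <;> omega
    · dsimp only
      split_ifs with h
      · obtain ⟨i, -, rfl⟩ := Finset.mem_map.1 h
        have := (Finset.mem_filter.1 (hTL (hfT i))).2
        omega
      · exact hud v
    · rw [Finset.sum_add_distrib, hsum, Finset.sum_boole, Finset.filter_mem_eq_inter,
        Finset.univ_inter, Finset.card_map, Finset.card_univ, Fintype.card_fin, Nat.cast_id,
        Nat.mul_succ]
    · rw [Finset.card_insert_of_notMem (fun h => hnle (hA _ h).1), hAt]
    · rcases Finset.mem_insert.1 hC with rfl | hC
      · exact ⟨le_sup_right, f, rfl⟩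
      · exact ⟨(hA C hC).1.trans le_sup_left, (hA C hC).2⟩

end SimpleGraph

/-! ### Turán numbers and asymptotics -/

open SimpleGraph

lemma not_free_cycleGraph_of_isCycle {V : Type*} {G : SimpleGraph V} {v : V} {c : G.Walk v v}
    (hc : c.IsCycle) : ¬ (cycleGraph c.length).Free G :=
  not_not_intro ((cycleGraph_isContained_iff hc.three_le_length).2 ⟨v, c, hc, rfl⟩)

lemma generalizedTuran_cycle_le {k l : ℕ} (hl : 2 ≤ l) (hkl : l < k) (n : ℕ) :
    generalizedTuran n (cycleGraph (2 * l + 1)) (cyclesUpTo (2 * l) ∪ {cycleMember (2 * k + 1)}) ≤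
      2 * (2 * (k - l) + 2) * n ^ 2 := by
  classical
  refine Finset.sup_le fun G hG => ?_
  have hG' : FamilyFree (cyclesUpTo (2 * l) ∪ {cycleMember (2 * k + 1)}) G := by
    simpa using hG
  refine copyCount_le_labelledCopyCount.trans ?_
  -- `m` is chosen so that `2 * l + m = 2 * k + 1`.
  refine (labelledCopyCount_cycleGraph_le (m := 2 * (k - l) + 1) hl (by omega)
    (fun v c hc => ?_) (fun v c hc h => ?_)).trans (by simp)
  · by_contra! hle
    exact not_free_cycleGraph_of_isCycle hc (hG' (cycleMember c.length)
      (Or.inl ⟨c.length, ⟨hc.three_le_length, hle⟩, rfl⟩))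
  · refine not_free_cycleGraph_of_isCycle hc (hG' (cycleMember c.length) (Or.inr ?_))
    rw [h, show 2 * l + (2 * (k - l) + 1) = 2 * k + 1 by omega]
    rfl

lemma le_generalizedTuran_cycle {k l : ℕ} (hl : 2 ≤ l) (hkl : l < k) {n d t : ℕ}
    (hn : 2 * ((2 * l + 1) * (2 * d + 1) ^ (2 * k)) ≤ n) (ht : 2 * (2 * l + 1) * t ≤ n * d) :
    t ≤ generalizedTuran n (cycleGraph (2 * l + 1))
      (cyclesUpTo (2 * l) ∪ {cycleMember (2 * k + 1)}) := by
  classical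
  obtain ⟨l, rfl⟩ : ∃ l', l = l' + 1 := ⟨l - 1, by omega⟩
  obtain ⟨G, hG, hGt⟩ := exists_graph_of_greedy_cycles (V := Fin n) (n := 2 * l + 1)
    (g := 2 * k + 1) (d := d) (by omega) (by simpa [Nat.mul_add] using hn) t
    (by simpa [Nat.mul_add] using ht)
  refine hGt.trans (Finset.le_sup (f := fun G : SimpleGraph (Fin n) => G.copyCount _)
    (Finset.mem_filter.2 ⟨Finset.mem_univ _, ?_⟩))
  have key : ∀ a, 3 ≤ a → a ≤ 2 * k + 1 → a ≠ 2 * l + 3 → (cycleGraph a).Free G := by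
    intro a ha hak hne hcon
    obtain ⟨v, c, hc, rfl⟩ := (cycleGraph_isContained_iff ha).1 hcon
    exact hne (hG v c hc hak)
  rintro A (⟨a, ha, rfl⟩ | rfl)
  · exact key a ha.1 (by have := ha.2; omega) (by have := ha.2; omega)
  · exact key (2 * k + 1) (by omega) le_rfl (by omega)

theorem theorem2p8 (k l : ℕ) (hl : 2 ≤ l) (hkl : l < k) :
    ((fun n : ℕ => (n : ℝ) ^ (1 + 1 / (2 * (k : ℝ) + 2))) =O[atTop]
      (fun n : ℕ => (generalizedTuran n (SimpleGraph.cycleGraph (2 * l + 1))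
        (cyclesUpTo (2 * l) ∪ {cycleMember (2 * k + 1)}) : ℝ))) ∧
    ((fun n : ℕ => (generalizedTuran n (SimpleGraph.cycleGraph (2 * l + 1))
        (cyclesUpTo (2 * l) ∪ {cycleMember (2 * k + 1)}) : ℝ)) =O[atTop]
      (fun n : ℕ => (n : ℝ) ^ 2)) := by
  constructor
  · set e : ℝ := 1 / (2 * (k : ℝ) + 2) with he
    have he0 : 0 < e := by positivity
    have hy : Tendsto (fun n : ℕ => (n : ℝ) ^ e) atTop atTop :=
      (tendsto_rpow_atTop he0).comp tendsto_natCast_atTop_atTop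
    refine IsBigO.of_bound (8 * (2 * l + 1)) ?_
    -- The first threshold lets one factor `y` absorb all constants in the ball bound; the second
    -- makes `t` at least `1`.
    filter_upwards [hy.eventually_ge_atTop (2 * (2 * l + 1) * 3 ^ (2 * k)),
      eventually_ge_atTop (4 * (2 * l + 1))] with n hn hn'
    set y : ℝ := (n : ℝ) ^ e with hydef
    have hn0 : (0 : ℝ) < n := by
      have : 0 < n := by omega
      exact_mod_cast this
    have hypow : y ^ (2 * k + 2) = n := by
      rw [hydef, ← Real.rpow_natCast, ← Real.rpow_mul hn0.le, he]
      push_cast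
      rw [one_div_mul_cancel (by positivity), Real.rpow_one]
    have h3 : (1 : ℝ) ≤ 3 ^ (2 * k) := one_le_pow₀ (by norm_num)
    have hy1 : 1 ≤ y := by
      refine le_trans ?_ hn
      have : (0 : ℝ) ≤ l := by positivity
      nlinarith
    set d := ⌊y⌋₊ with hd
    have hdy : (d : ℝ) ≤ y := Nat.floor_le (by linarith)
    have hd1 : 1 ≤ d := Nat.le_floor (by simpa using hy1)
    have hd1' : (1 : ℝ) ≤ d := by exact_mod_cast hd1
    have hyd : y < d + 1 := Nat.lt_floor_add_one y
    set t := n * d / (2 * (2 * l + 1)) with ht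
    have hcount := le_generalizedTuran_cycle hl hkl (n := n) (d := d) (t := t) (by
      have : (2 * ((2 * l + 1) * (2 * d + 1) ^ (2 * k)) : ℝ) ≤ n := by
        have h1 : (2 * d + 1 : ℝ) ^ (2 * k) ≤ (3 * y) ^ (2 * k) := by
          gcongr
          linarith
        calc (2 * ((2 * l + 1) * (2 * d + 1) ^ (2 * k)) : ℝ)
            ≤ 2 * ((2 * l + 1) * (3 * y) ^ (2 * k)) := by gcongr
          _ = (2 * (2 * l + 1) * 3 ^ (2 * k)) * y ^ (2 * k) := by rw [mul_pow]; ring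
          _ ≤ y * y ^ (2 * k) := by gcongr
          _ ≤ y * (y * y ^ (2 * k)) := by
            gcongr
            exact le_mul_of_one_le_left (by positivity) hy1
          _ = n := by rw [← hypow]; ring
      exact_mod_cast this) (Nat.mul_div_le _ _)
    have hcount' : (t : ℝ) ≤ (generalizedTuran n (SimpleGraph.cycleGraph (2 * l + 1))
        (cyclesUpTo (2 * l) ∪ {cycleMember (2 * k + 1)}) : ℝ) := by exact_mod_cast hcount
    have ht' : (n * d : ℝ) ≤ 2 * (2 * l + 1) * (t + 1) := by
      have := (Nat.lt_mul_div_succ (n * d) (show 0 < 2 * (2 * l + 1) by omega)).le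
      exact_mod_cast this
    have ht1 : (1 : ℝ) ≤ t := by
      have : 1 ≤ t := by
        rw [ht, Nat.le_div_iff_mul_le (by omega)]
        nlinarith
      exact_mod_cast this
    rw [Real.rpow_add hn0, Real.rpow_one, Real.norm_of_nonneg (by positivity),
      Real.norm_of_nonneg (by positivity)]
    -- Both floors cost a factor two: `y ≤ 2 * d` and `t + 1 ≤ 2 * t`.
    calc (n : ℝ) * y ≤ n * (2 * d) := by gcongr; linarith
      _ = 2 * (n * d) := by ring
      _ ≤ 2 * (2 * (2 * l + 1) * (t + t)) := by
        refine mul_le_mul_of_nonneg_left (ht'.trans ?_) (by norm_num)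
        gcongr
      _ = 8 * (2 * l + 1) * t := by ring
      _ ≤ _ := by gcongr
  · refine IsBigO.of_bound (2 * (2 * (k - l : ℕ) + 2)) (Eventually.of_forall fun n => ?_)
    rw [Real.norm_of_nonneg (by positivity), Real.norm_of_nonneg (by positivity)]
    exact_mod_cast generalizedTuran_cycle_le hl hkl n
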